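/- Let $\mathcal{A}=\mathbb{C}[x_0,\dots,x_4]$ be the homogeneous coordinate ring of $\mathbb{P}^4$, let $\alpha,\beta$ be $3\times 3$ matrices over $\mathcal{A}$, and let $A=(\alpha\;\beta)$ be the $3\times 6$ matrix obtained by placing them side by side. Assume that the entries of the first row of $A$ are cubic forms, that the entries of its second and third rows are linear forms (zero being allowed as a form), and that $\alpha\beta^t=\beta\alpha^t$. Let $A'$ be the $2\times 6$ matrix obtained from $A$ by erasing the first row, and assume that the locus where $A'$ drops rank, $\{p\in\mathbb{P}^4 : \operatorname{rank}A'(p)\le 1\}$, consists of exactly $3$ distinct points. For a matrix $M$ over $\mathcal{A}$ let $I_2(M)\subseteq\mathcal{A}$ denote the ideal generated by all $2\times 2$ minors of $M$. Then $$I_2(A)=I_2(A').$$ -/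

import Mathlib

open scoped LinearAlgebra.Projectivization

/-- The ideal `I_t(M)` of a commutative ring generated by all `t × t` minors of `M`. The row and
column choices are injections, so a minor may occur up to sign according to the ordering. -/
def minorIdeal {R m n : Type*} [CommRing R] (t : ℕ) (M : Matrix m n R) : Ideal R :=
  Ideal.span {d : R | ∃ (r : Fin t ↪ m) (c : Fin t ↪ n), d = (M.submatrix r c).det}

/-- The degeneracy locus in the projective space with homogeneous coordinate ring `K[x_i : i ∈ σ]`
of a matrix `M` of polynomials: the set of points at which the rank of `M` is less than its number
of rows. When the entries of each row are homogeneous of one degree, replacing the representative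
of a point rescales the rows by nonzero scalars, so the condition does not depend on it. -/
def degeneracyLocus {K σ m n : Type*} [Field K] [Fintype m] [Fintype n]
    (M : Matrix m n (MvPolynomial σ K)) : Set (ℙ K (σ → K)) :=
  {p | (M.map (MvPolynomial.eval p.rep)).rank < Fintype.card m}

/-- The matrix `A'` obtained from `A` by erasing its first row. -/
def eraseFirstRow {R n : Type*} {k : ℕ} (A : Matrix (Fin (k + 1)) n R) : Matrix (Fin k) n R :=
  A.submatrix Fin.succ id

/-!
Write the rows of `A` at a point `v` of `V = ℂ⁵` as vectors `g v`, `f₀ v`, `f₁ v` of the symplectic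
space `E = ℂ⁶`; the condition `α βᵗ = β αᵗ` says that they are pairwise orthogonal for the standard
form `ω`. Here `f₀, f₁` are linear in `v` and `g` is cubic. Only the minors that involve the first
row need an argument. They are quartic forms, and two facts put them into the ideal `I` of the
`2 × 2` minors of `f₀, f₁`: a form of degree at least two that vanishes at the three points of the
degeneracy locus lies in `I`, and the minors do vanish at these points.

Both facts come from a normal form. A base change of the rows gives a pencil `R, S` such that
`S`, `R`, `R - S` vanish at the three points `p`, `q`, `r` (`exists_isThreePointPencil`). The
vectors `R p`, `S q`, `R r` are independent and span a Lagrangian subspace, since a dependence would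
produce a line or a conic of points of rank at most one. Pairing `R` and `S` with these three
vectors gives linear forms `l`, `k`, `m`, which are columns `(l, 0)`, `(0, k)`, `(m, m)` of the
`2 × 6` matrix. Any two of them vanish together only on the span `U` of the three points
(`IsThreePointPencil.mem_span_of_form_eq_zero`): from a further common zero one constructs a fourth
point of rank at most one. Hence every linear form that vanishes on `U` is a combination of any two
of them, and this allows one to choose further columns `(y₀, 0)`, `(0, y₁)`, `(y₂, y₂)` with
`y₀, y₁, y₂` dual to `p, q, r` (`IsThreePointPencil.exists_coordinates`). The minors of these six
columns show that `I` contains all products of two of `y₀, y₁, y₂, l, m` except the `yᵢ²`. So modulo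
`I` a form of degree `n ≥ 2` is a combination of the `yᵢⁿ`, and its coefficients are its values at
the three points (`IsThreePointPencil.mem_of_isHomogeneous`).

For the vanishing at `p`, where `S p = 0`, the orthogonality of `g` and `S` along lines through `p`
shows that `g p` is orthogonal to the whole image of `S`. As `g p` is also orthogonal to `R p`, it
lies in the Lagrangian subspace, and independence of `k` and `m` makes it a multiple of `R p`
(`IsThreePointPencil.exists_eq_smul_of_orthogonal`). All rows of `A` are then proportional at `p`,
and the symmetries of the normal form transfer this to `q` and `r`.
-/

/-! ### Isotropic pencils with three points of rank one -/

section Pencil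

variable {K V E : Type*} [Field K] [AddCommGroup V] [Module K V] [AddCommGroup E] [Module K E]

/-- Two linear maps `R, S : V → E`, read as a `2 × dim E` matrix of linear forms on `V`, such that
`(R v, S v)` is a pair of `ω`-orthogonal vectors for every `v`, and has rank at most one only on the
three distinct lines spanned by `p`, `q`, `r`. The basis `R, S` of the pencil is adapted to these
lines: `S`, `R` and `R - S` vanish at `p`, `q` and `r` respectively. -/
structure IsThreePointPencil (ω : LinearMap.BilinForm K E) (R S : V →ₗ[K] E) (p q r : V) :
    Prop where
  R_q : R q = 0
  S_p : S p = 0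
  R_r : R r = S r
  pq : LinearIndependent K ![p, q]
  pr : LinearIndependent K ![p, r]
  qr : LinearIndependent K ![q, r]
  isotropic : ∀ v, ω (R v) (S v) = 0
  only : ∀ v (s t : K), (s ≠ 0 ∨ t ≠ 0) → s • R v + t • S v = 0 →
    ∃ k : K, v = k • p ∨ v = k • q ∨ v = k • r

namespace IsThreePointPencil

variable {ω : LinearMap.BilinForm K E} {R S : V →ₗ[K] E} {p q r : V}

/-- The symmetry that exchanges the first and the second point. -/
lemma swap (hω : ω.IsAlt) (h : IsThreePointPencil ω R S p q r) :
    IsThreePointPencil ω S R q p r where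
  R_q := h.S_p
  S_p := h.R_q
  R_r := h.R_r.symm
  pq := LinearIndependent.pair_symm_iff.1 h.pq
  pr := h.qr
  qr := h.pr
  isotropic v := by rw [← hω.neg_eq, h.isotropic, neg_zero]
  only v s t hst hv := by
    obtain ⟨k, hk⟩ := h.only v t s hst.symm (by rw [add_comm]; exact hv)
    exact ⟨k, by tauto⟩

/-- The symmetry that exchanges the second and the third point. -/
lemma transpose (hω : ω.IsAlt) (h : IsThreePointPencil ω R S p q r) :
    IsThreePointPencil ω (R - S) (-S) p r q where
  R_q := by simp [h.R_r]
  S_p := by simp [h.S_p]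
  R_r := by simp [h.R_q]
  pq := h.pr
  pr := h.pq
  qr := LinearIndependent.pair_symm_iff.1 h.qr
  isotropic v := by simp [h.isotropic, hω.self_eq_zero]
  only v s t hst hv := by
    obtain ⟨k, hk⟩ := h.only v s (-s - t) (by
      by_contra! hc
      obtain ⟨rfl, hc⟩ := hc
      simp at hc
      simp [hc] at hst) (by
      rw [← hv]; simp only [LinearMap.sub_apply, LinearMap.neg_apply]; module)
    exact ⟨k, by tauto⟩

/-- The symmetry that moves the third point to the first place. -/
lemma rotate (hω : ω.IsAlt) (h : IsThreePointPencil ω R S p q r) :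
    IsThreePointPencil ω (-S) (R - S) r p q :=
  (h.transpose hω).swap hω

/-- The vectors of `E` over two of the points are independent: otherwise the whole line joining
these points would lie in the locus of rank at most one. -/
lemma indep_pair [CharZero K] (h : IsThreePointPencil ω R S p q r) (x y : K)
    (hxy : x • R p + y • S q = 0) : x = 0 ∧ y = 0 := by
  by_contra hc
  have hc' : x ≠ 0 ∨ y ≠ 0 := by tauto
  have hpq := LinearIndependent.pair_iff.1 h.pq
  have hqr := LinearIndependent.pair_iff.1 h.qr
  have key : ∀ c : K, c ≠ 0 → ∃ k : K, p + c • q = k • r := by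
    intro c hc0
    obtain ⟨k, hk | hk | hk⟩ := h.only (p + c • q) x (c⁻¹ * y)
      (by rcases hc' with h1 | h1
          · exact Or.inl h1
          · exact Or.inr (mul_ne_zero (inv_ne_zero hc0) h1))
      (by
        rw [← hxy]
        simp only [map_add, map_smul, h.R_q, h.S_p]
        rw [zero_add, smul_zero, add_zero, smul_smul, mul_right_comm, inv_mul_cancel₀ hc0, one_mul])
    · exact absurd (hpq (1 - k) c (by rw [sub_smul, ← hk]; module)).2 hc0
    · exact absurd (hpq 1 (c - k) (by rw [sub_smul, ← hk]; module)).1 one_ne_zero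
    · exact ⟨k, hk⟩
  obtain ⟨k, hk⟩ := key 1 one_ne_zero
  obtain ⟨k', hk'⟩ := key 2 two_ne_zero
  refine one_ne_zero (hqr 1 (k - k') ?_).1
  rw [sub_smul, ← hk, ← hk']
  module

/-- The vectors over the three points are independent: otherwise the plane joining the three points
would meet the locus of rank at most one in a conic. -/
lemma indep [CharZero K] (hω : ω.IsAlt) (h : IsThreePointPencil ω R S p q r) (x y z : K)
    (hxyz : x • R p + y • S q + z • R r = 0) : x = 0 ∧ y = 0 ∧ z = 0 := by
  have hac : ∀ x y : K, x • R p + y • R r = 0 → x = 0 ∧ y = 0 := fun x y hxy ↦ by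
    simpa using (h.transpose hω).indep_pair x (-y) (by
      rw [← hxy, h.R_r]; simp [h.S_p])
  have hbc : ∀ x y : K, x • S q + y • R r = 0 → x = 0 ∧ y = 0 := fun x y hxy ↦ by
    simpa using ((h.swap hω).transpose hω).indep_pair x (-y) (by
      rw [← hxy]; simp [h.R_q])
  by_cases hz : z = 0
  · subst hz
    simpa using h.indep_pair x y (by simpa using hxyz)
  exfalso
  obtain ⟨a, b, hc⟩ : ∃ a b : K, R r = a • R p + b • S q := by
    refine ⟨-z⁻¹ * x, -z⁻¹ * y, ?_⟩
    have : z⁻¹ • (x • R p + y • S q + z • R r) = 0 := by rw [hxyz, smul_zero]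
    rw [smul_add, smul_smul z⁻¹ z, inv_mul_cancel₀ hz, one_smul] at this
    rw [eq_neg_of_add_eq_zero_right this]
    module
  have h2 : (2 : K) ≠ 0 := two_ne_zero
  -- a point of the conic that is none of the three given ones
  obtain ⟨k, hk⟩ := h.only (a • p - (b / 2) • q + r) 1 (-2) (Or.inl one_ne_zero) (by
    simp only [map_add, map_sub, map_smul, h.R_q, h.S_p, ← h.R_r, hc]
    match_scalars
    · ring
    · field_simp; ring)
  have hR : ∀ v, v = k • p ∨ v = k • q ∨ v = k • r → R v = k • R p ∨ R v = 0 ∨ R v = k • R r := by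
    rintro v (rfl | rfl | rfl) <;> simp [h.R_q]
  have hRv : R (a • p - (b / 2) • q + r) = a • R p + R r := by simp [h.R_q]
  rcases hR _ hk with hk | hk | hk <;> rw [hRv] at hk
  · exact one_ne_zero (hac (a - k) 1 (by rw [sub_smul, ← hk]; module)).2
  · exact one_ne_zero (hac a 1 (by rw [← hk]; module)).2
  · have ha := (hac a (1 - k) (by rw [sub_smul, ← hk]; module)).1
    rw [ha, zero_smul, zero_add] at hc
    exact one_ne_zero (neg_eq_zero.1 (hbc b (-1) (by rw [hc]; module)).2)

lemma polar (h : IsThreePointPencil ω R S p q r) (v w : V) :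
    ω (R v) (S w) + ω (R w) (S v) = 0 := by
  have := h.isotropic (v + w)
  simpa [h.isotropic] using this

lemma form_p_S (h : IsThreePointPencil ω R S p q r) (v : V) : ω (R p) (S v) = 0 := by
  simpa [h.S_p] using h.polar p v

lemma form_q_R (hω : ω.IsAlt) (h : IsThreePointPencil ω R S p q r) (v : V) : ω (S q) (R v) = 0 :=
  (h.swap hω).form_p_S v

lemma form_r (hω : ω.IsAlt) (h : IsThreePointPencil ω R S p q r) (v : V) :
    ω (R r) (S v) = ω (R r) (R v) := by
  have := h.polar v r
  rw [← h.R_r, ← hω.neg_eq (R r)] at this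
  linear_combination this

/-- The vectors over the three points span a Lagrangian subspace. -/
lemma lagrangian [CharZero K] [FiniteDimensional K E] (hE : Module.finrank K E = 6)
    (hω : ω.IsAlt) (hn : ω.Nondegenerate) (h : IsThreePointPencil ω R S p q r) {w : E}
    (hp : ω (R p) w = 0) (hq : ω (S q) w = 0) (hr : ω (R r) w = 0) :
    ∃ x y z : K, w = x • R p + y • S q + z • R r := by
  set u : Fin 3 → E := ![R p, S q, R r] with hu
  have hli : LinearIndependent K u := by
    rw [Fintype.linearIndependent_iff]
    intro g hg
    simp only [hu, Fin.sum_univ_three] at hg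
    obtain ⟨h0, h1, h2⟩ := h.indep hω _ _ _ hg
    intro i
    fin_cases i <;> assumption
  have hrank : Module.finrank K (Submodule.span K (Set.range u)) = 3 := by
    simpa using finrank_span_eq_card hli
  have hort : Module.finrank K (ω.orthogonal (Submodule.span K (Set.range u))) = 3 := by
    rw [LinearMap.BilinForm.finrank_orthogonal hn, hrank, hE]
  have hmem : ∀ w, (∀ i, ω (u i) w = 0) → w ∈ ω.orthogonal (Submodule.span K (Set.range u)) := by
    intro w hw v hv
    refine Submodule.span_induction (p := fun v _ ↦ ω v w = 0) ?_ ?_ ?_ ?_ hv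
    · rintro _ ⟨i, rfl⟩; exact hw i
    · simp
    · intro x y _ _ hx hy; simp [hx, hy]
    · intro a x _ hx; simp [hx]
  have hab : ω (R p) (S q) = 0 := h.form_p_S q
  have hac : ω (R p) (R r) = 0 := by rw [h.R_r]; exact h.form_p_S r
  have hbc : ω (S q) (R r) = 0 := h.form_q_R hω r
  have hle : Submodule.span K (Set.range u) ≤ ω.orthogonal (Submodule.span K (Set.range u)) := by
    rw [Submodule.span_le]
    rintro _ ⟨j, rfl⟩
    refine hmem _ fun i ↦ ?_
    fin_cases i <;> fin_cases j <;>
      simp [hu, hab, hac, hbc, hω.self_eq_zero, ← hω.neg_eq (R p) (S q), ← hω.neg_eq (R p) (R r),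
        ← hω.neg_eq (S q) (R r)]
  have heq := Submodule.eq_of_le_of_finrank_eq hle (hrank.trans hort.symm)
  have hw : w ∈ Submodule.span K (Set.range u) := by
    rw [heq]
    refine hmem _ fun i ↦ ?_
    fin_cases i <;> assumption
  obtain ⟨g, hg⟩ := (Submodule.mem_span_range_iff_exists_fun K).1 hw
  exact ⟨g 0, g 1, g 2, by rw [← hg, Fin.sum_univ_three]; rfl⟩

/-- The two linear forms `ω (R p) ∘ R` and `ω (R r) ∘ R` vanish together only on the span of the
three points. At a further common zero, a fourth point of rank at most one would appear. -/
lemma mem_span_of_form_eq_zero [CharZero K] [FiniteDimensional K E] (hE : Module.finrank K E = 6)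
    (hω : ω.IsAlt) (hn : ω.Nondegenerate) (h : IsThreePointPencil ω R S p q r) {v : V}
    (hp : ω (R p) (R v) = 0) (hr : ω (R r) (R v) = 0) :
    ∃ x y z : K, v = x • p + y • q + z • r := by
  have hlines : ∀ w, (∃ k : K, w = k • p ∨ w = k • q ∨ w = k • r) →
      ∀ x y z : K, v = w + (x • p + y • q + z • r) → ∃ x y z : K, v = x • p + y • q + z • r := by
    rintro w ⟨k, rfl | rfl | rfl⟩ x y z hv
    · exact ⟨x + k, y, z, by rw [hv]; module⟩
    · exact ⟨x, y + k, z, by rw [hv]; module⟩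
    · exact ⟨x, y, z + k, by rw [hv]; module⟩
  obtain ⟨x, y, z, hRv⟩ := h.lagrangian hE hω hn hp (h.form_q_R hω v) hr
  set v' := v - x • p - z • r with hv'
  have hv : v = v' + (x • p + (0 : K) • q + z • r) := by rw [hv']; module
  have hRv' : R v' = y • S q := by rw [hv']; simp only [map_sub, map_smul, hRv]; module
  have hy : y * ω (S q) (S v') = 0 := by simpa [hRv'] using h.isotropic v'
  rcases mul_eq_zero.1 hy with rfl | hy
  · refine hlines v' (h.only v' 1 0 (Or.inl one_ne_zero) ?_) _ _ _ hv
    simp [hRv']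
  · have hr' : ω (R r) (S v') = 0 := by
      rw [h.form_r hω, hRv', map_smul, ← hω.neg_eq, h.form_q_R hω]; simp
    obtain ⟨x', y', z', hSv'⟩ := h.lagrangian hE hω hn (h.form_p_S v') hy hr'
    have h2 : (2 : K) ≠ 0 := two_ne_zero
    -- correct `v'` by the three points so that `S = 2 R` there
    refine hlines (v' + ((x' / 2) • p + (2 * y - y') • q + z' • r))
      (h.only _ 2 (-1) (Or.inl two_ne_zero) ?_) (x - x' / 2) (-(2 * y - y')) (z - z') ?_
    · simp only [map_add, map_smul, h.R_q, h.S_p, ← h.R_r, hRv', hSv']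
      match_scalars <;> field_simp <;> ring
    · rw [hv]; module

/-- If the common zeros of `l` and `m` lie in the span of the three points, then `l` and `m` span all
linear forms that vanish at these points. -/
lemma eq_combination_of_vanish {φ l m : V →ₗ[K] K} (hp : φ p = 0) (hq : φ q = 0) (hr : φ r = 0)
    (hlm : ∀ v, l v = 0 → m v = 0 → ∃ x y z : K, v = x • p + y • q + z • r) :
    ∃ x y : K, φ = x • l + y • m := by
  have : φ ∈ Submodule.span K (Set.range ![l, m]) := by
    refine mem_span_of_iInf_ker_le_ker fun v hv ↦ ?_
    rw [Submodule.mem_iInf] at hv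
    obtain ⟨x, y, z, rfl⟩ := hlm v (hv 0) (hv 1)
    simp [hp, hq, hr]
  obtain ⟨g, hg⟩ := (Submodule.mem_span_range_iff_exists_fun K).1 this
  exact ⟨g 0, g 1, by rw [← hg, Fin.sum_univ_two]; rfl⟩

/-- A vector orthogonal to `R p` and to the image of `S` is a multiple of `R p`. -/
lemma eq_smul_of_form_eq_zero [CharZero K] [FiniteDimensional K E] [FiniteDimensional K V]
    (hE : Module.finrank K E = 6) (hV : Module.finrank K V = 5)
    (hω : ω.IsAlt) (hn : ω.Nondegenerate) (h : IsThreePointPencil ω R S p q r) {w : E}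
    (hp : ω (R p) w = 0) (hS : ∀ v, ω w (S v) = 0) : ∃ x : K, w = x • R p := by
  have hS' : ∀ v, ω (S v) w = 0 := fun v ↦ by rw [← hω.neg_eq, hS, neg_zero]
  obtain ⟨x, y, z, rfl⟩ := h.lagrangian hE hω hn hp (hS' q) (by rw [h.R_r]; exact hS' r)
  have hnm : ∀ v, y * ω (S q) (S v) + z * ω (R r) (S v) = 0 := fun v ↦ by
    simpa [h.form_p_S] using hS v
  have hU : ∀ v, ω (S q) (S v) = 0 → ω (R r) (S v) = 0 →
      ∃ x y z : K, v = x • p + y • q + z • r := fun v h1 h2 ↦ by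
    obtain ⟨a, b, c, habc⟩ := (h.swap hω).mem_span_of_form_eq_zero hE hω hn h1
      (by rw [← h.R_r]; exact h2)
    exact ⟨b, a, c, by rw [habc]; module⟩
  -- a hyperplane of `V` is not contained in the span of the three points
  have hbig : ∀ φ : V →ₗ[K] K, ¬ ∀ v, φ v = 0 → ∃ x y z : K, v = x • p + y • q + z • r := by
    intro φ hφ
    have h1 : LinearMap.ker φ ≤ Submodule.span K (Set.range ![p, q, r]) := by
      intro v hv
      obtain ⟨x, y, z, rfl⟩ := hφ v hv
      exact (Submodule.mem_span_range_iff_exists_fun K).2 ⟨![x, y, z], by simp [Fin.sum_univ_three]⟩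
    have h2 := Submodule.finrank_mono h1
    have h3 : Module.finrank K (Submodule.span K (Set.range ![p, q, r])) ≤ 3 := by
      exact (finrank_range_le_card (R := K) ![p, q, r]).trans (by simp)
    have h4 := φ.finrank_range_add_finrank_ker
    have h5 := Submodule.finrank_le (LinearMap.range φ)
    rw [Module.finrank_self] at h5
    omega
  have hy : y = 0 := by
    by_contra hy
    refine hbig ((ω (R r)).comp S) fun v hv ↦ hU v ?_ hv
    have := hnm v
    rw [LinearMap.comp_apply] at hv
    simpa [hv, hy] using this
  have hz : z = 0 := by
    by_contra hz
    refine hbig ((ω (S q)).comp S) fun v hv ↦ hU v hv ?_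
    have := hnm v
    rw [LinearMap.comp_apply] at hv
    simpa [hv, hz] using this
  exact ⟨x, by simp [hy, hz]⟩

/-- A coordinate of `E` dual to `R p` along the three vectors over the points can be chosen to
vanish on the image of `S`: the failure of an arbitrary one is corrected by `ω (S q)` and
`ω (R r)`, which vanish on those vectors. -/
lemma exists_dual [CharZero K] [FiniteDimensional K E] (hE : Module.finrank K E = 6)
    (hω : ω.IsAlt) (hn : ω.Nondegenerate) (h : IsThreePointPencil ω R S p q r) :
    ∃ φ : E →ₗ[K] K, φ (R p) = 1 ∧ φ (S q) = 0 ∧ φ (R r) = 0 ∧ ∀ v, φ (S v) = 0 := by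
  have hnot : R p ∉ Submodule.span K {S q, R r} := by
    rw [Submodule.mem_span_pair]
    rintro ⟨a, b, hab⟩
    exact one_ne_zero (h.indep hω 1 (-a) (-b) (by rw [← hab]; module)).1
  obtain ⟨f, hf, hker⟩ := Submodule.exists_le_ker_of_notMem hnot
  have hfq : f (S q) = 0 := hker (Submodule.subset_span (by simp))
  have hfr : f (R r) = 0 := hker (Submodule.subset_span (by simp))
  obtain ⟨x, y, hxy⟩ := eq_combination_of_vanish (φ := f.comp S) (p := p) (q := q) (r := r)
    (l := (ω (S q)).comp S) (m := (ω (R r)).comp S) (by simp [h.S_p]) hfq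
    (by rw [LinearMap.comp_apply, ← h.R_r, hfr]) fun v h1 h2 ↦ by
      obtain ⟨a, b, c, habc⟩ := (h.swap hω).mem_span_of_form_eq_zero hE hω hn h1
        (by rw [← h.R_r]; exact h2)
      exact ⟨b, a, c, by rw [habc]; module⟩
  refine ⟨(f (R p))⁻¹ • (f - x • ω (S q) - y • ω (R r)), ?_, ?_, ?_, fun v ↦ ?_⟩
  · simp [h.form_q_R hω, ← h.form_r hω p, h.S_p, hf]
  · simp [hfq, hω.self_eq_zero, h.form_r hω, h.R_q]
  · simp [hfr, hω.self_eq_zero, h.form_q_R hω]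
  · have := LinearMap.congr_fun hxy v
    simp only [LinearMap.comp_apply, LinearMap.add_apply, LinearMap.smul_apply] at this
    simp [this]

/-- If a continuous vector field `g` is orthogonal to both rows of the pencil everywhere, then at
the point `p` it is proportional to the row `R p`. -/
lemma exists_eq_smul_of_orthogonal {V E : Type*} [AddCommGroup V] [Module ℂ V] [AddCommGroup E]
    [Module ℂ E] [FiniteDimensional ℂ E] [FiniteDimensional ℂ V] [TopologicalSpace V]
    [ContinuousAdd V] [ContinuousSMul ℂ V] {ω : LinearMap.BilinForm ℂ E} {R S : V →ₗ[ℂ] E}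
    {p q r : V} (hE : Module.finrank ℂ E = 6) (hV : Module.finrank ℂ V = 5)
    (hω : ω.IsAlt) (hn : ω.Nondegenerate) (h : IsThreePointPencil ω R S p q r) {g : V → E}
    (hg : ∀ e, Continuous fun v ↦ ω (g v) e) (hR : ∀ v, ω (g v) (R v) = 0)
    (hS : ∀ v, ω (g v) (S v) = 0) : ∃ x : ℂ, g p = x • R p := by
  refine h.eq_smul_of_form_eq_zero hE hV hω hn (by rw [← hω.neg_eq, hR, neg_zero]) fun v ↦ ?_
  -- since `S p = 0`, the function below vanishes for `t ≠ 0`, hence at `t = 0`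
  have hc : Continuous fun t : ℂ ↦ ω (g (p + t • v)) (S v) := (hg (S v)).comp (by fun_prop)
  have h0 : (fun t : ℂ ↦ ω (g (p + t • v)) (S v)) = fun _ ↦ 0 := by
    refine hc.ext_on (dense_compl_singleton (0 : ℂ)) continuous_const fun t ht ↦ ?_
    have := hS (p + t • v)
    rw [map_add, h.S_p, zero_add, map_smul, map_smul, smul_eq_mul] at this
    exact (mul_eq_zero.1 this).resolve_left ht
  simpa using congrFun h0 0

end IsThreePointPencil

/-- A nonzero combination of the rows of a pencil does not vanish at two of the three points, as it
would vanish on the line joining them. -/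
lemma false_of_vanish_of_vanish [CharZero K] {f g : V →ₗ[K] E} {u v w : V} {s t : K}
    (huv : LinearIndependent K ![u, v]) (hvw : LinearIndependent K ![v, w])
    (hloc : ∀ x, s • f x + t • g x = 0 → ∃ k : K, x = k • u ∨ x = k • v ∨ x = k • w)
    (hu : s • f u + t • g u = 0) (hv : s • f v + t • g v = 0) : False := by
  have huv := LinearIndependent.pair_iff.1 huv
  have hvw := LinearIndependent.pair_iff.1 hvw
  have key : ∀ c : K, c ≠ 0 → ∃ k : K, u + c • v = k • w := by
    intro c hc
    obtain ⟨k, hk | hk | hk⟩ := hloc (u + c • v) (by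
      have : s • f (u + c • v) + t • g (u + c • v) =
        (s • f u + t • g u) + c • (s • f v + t • g v) := by
        simp only [map_add, map_smul]; module
      rw [this, hu, hv, smul_zero, add_zero])
    · exact absurd (huv (1 - k) c (by rw [sub_smul, ← hk]; module)).2 hc
    · exact absurd (huv 1 (c - k) (by rw [sub_smul, ← hk]; module)).1 one_ne_zero
    · exact ⟨k, hk⟩
  obtain ⟨k, hk⟩ := key 1 one_ne_zero
  obtain ⟨k', hk'⟩ := key 2 two_ne_zero
  exact one_ne_zero (hvw 1 (k - k') (by rw [sub_smul, ← hk, ← hk']; module)).1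

lemma combination_eq_zero_of_det_eq_zero {x y : E} {s t s' t' : K} (hst' : s' ≠ 0 ∨ t' ≠ 0)
    (h : s' • x + t' • y = 0) (hdet : s * t' - t * s' = 0) : s • x + t • y = 0 := by
  rcases hst' with h1 | h1
  · have : s • x + t • y = (s / s') • (s' • x + t' • y) := by
      match_scalars
      · field_simp
      · field_simp; linear_combination -hdet
    rw [this, h, smul_zero]
  · have : s • x + t • y = (t / t') • (s' • x + t' • y) := by
      match_scalars
      · field_simp; linear_combination hdet
      · field_simp
    rw [this, h, smul_zero]

/-- A pencil of rank at most one exactly on the lines spanned by `p`, `q`, `r` has a basis adapted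
to these lines. -/
lemma exists_isThreePointPencil [CharZero K] {ω : LinearMap.BilinForm K E} (hω : ω.IsAlt)
    {f g : V →ₗ[K] E} {p q r : V} (pq : LinearIndependent K ![p, q])
    (pr : LinearIndependent K ![p, r]) (qr : LinearIndependent K ![q, r])
    (hfg : ∀ v, ω (f v) (g v) = 0)
    (hloc : ∀ v, (∃ s t : K, (s ≠ 0 ∨ t ≠ 0) ∧ s • f v + t • g v = 0) ↔
      ∃ k : K, v = k • p ∨ v = k • q ∨ v = k • r) :
    ∃ a b c d : K, a * d - b * c ≠ 0 ∧
      IsThreePointPencil ω (a • f + b • g) (c • f + d • g) p q r := by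
  have hloc' : ∀ {s t : K}, (s ≠ 0 ∨ t ≠ 0) → ∀ x, s • f x + t • g x = 0 →
      ∃ k : K, x = k • p ∨ x = k • q ∨ x = k • r := fun hst x hx ↦ (hloc x).1 ⟨_, _, hst, hx⟩
  obtain ⟨c, d, hcd, hp⟩ := (hloc p).2 ⟨1, by simp⟩
  obtain ⟨a, b, hab, hq⟩ := (hloc q).2 ⟨1, by simp⟩
  obtain ⟨s, t, hst, hr⟩ := (hloc r).2 ⟨1, by simp⟩
  -- combinations vanishing at different points are not proportional
  have D1 : a * d - b * c ≠ 0 := fun h0 ↦ by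
    refine false_of_vanish_of_vanish (LinearIndependent.pair_symm_iff.1 pq) pr (fun x hx ↦ ?_) hq
      (combination_eq_zero_of_det_eq_zero hcd hp h0)
    obtain ⟨k, hk⟩ := hloc' hab x hx
    exact ⟨k, by tauto⟩
  have D2 : s * d - t * c ≠ 0 := fun h0 ↦ by
    refine false_of_vanish_of_vanish (LinearIndependent.pair_symm_iff.1 pr) pq (fun x hx ↦ ?_) hr
      (combination_eq_zero_of_det_eq_zero hcd hp h0)
    obtain ⟨k, hk⟩ := hloc' hst x hx
    exact ⟨k, by tauto⟩
  have D3 : s * b - t * a ≠ 0 := fun h0 ↦ by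
    refine false_of_vanish_of_vanish (LinearIndependent.pair_symm_iff.1 qr)
      (LinearIndependent.pair_symm_iff.1 pq) (fun x hx ↦ ?_) hr
      (combination_eq_zero_of_det_eq_zero hab hq h0)
    obtain ⟨k, hk⟩ := hloc' hst x hx
    exact ⟨k, by tauto⟩
  -- rescale the two combinations so that their difference is a multiple of `s • f + t • g`
  set e := s * d - t * c with he
  set e' := s * b - t * a with he'
  refine ⟨e * a, e * b, e' * c, e' * d, ?_, ?_⟩
  · have : e * a * (e' * d) - e * b * (e' * c) = e * e' * (a * d - b * c) := by ring
    rw [this]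
    exact mul_ne_zero (mul_ne_zero D2 D3) D1
  · refine ⟨?_, ?_, ?_, pq, pr, qr, fun v ↦ ?_, fun v x y hxy hv ↦ (hloc v).1
      ⟨x * (e * a) + y * (e' * c), x * (e * b) + y * (e' * d), ?_, ?_⟩⟩
    · simp only [LinearMap.add_apply, LinearMap.smul_apply]
      rw [mul_smul, mul_smul, ← smul_add, hq, smul_zero]
    · simp only [LinearMap.add_apply, LinearMap.smul_apply]
      rw [mul_smul, mul_smul, ← smul_add, hp, smul_zero]
    · rw [← sub_eq_zero]
      have : ((e * a) • f + (e * b) • g) r - ((e' * c) • f + (e' * d) • g) r =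
          (a * d - b * c) • (s • f r + t • g r) := by
        simp only [LinearMap.add_apply, LinearMap.smul_apply, he, he']
        module
      rw [this, hr, smul_zero]
    · have hgf : ω (g v) (f v) = 0 := by rw [← hω.neg_eq, hfg, neg_zero]
      simp [hfg, hgf, hω.self_eq_zero]
    · by_contra! hc
      obtain ⟨h1, h2⟩ := hc
      have hx : x * (e * (a * d - b * c)) = 0 := by linear_combination d * h1 - c * h2
      have hy : y * (e' * (a * d - b * c)) = 0 := by linear_combination a * h2 - b * h1
      have hx0 := (mul_eq_zero.1 hx).resolve_right (mul_ne_zero D2 D1)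
      have hy0 := (mul_eq_zero.1 hy).resolve_right (mul_ne_zero D3 D1)
      tauto
    · rw [← hv]
      simp only [LinearMap.add_apply, LinearMap.smul_apply]
      module

end Pencil

/-! ### Linear forms as polynomials -/

section LinForm

open MvPolynomial

variable {K σ : Type*} [Field K] [Fintype σ] [DecidableEq σ]

/-- The polynomial `∑ φ (e_i) X_i` of degree one that induces the linear functional `φ`. -/
noncomputable def linForm : ((σ → K) →ₗ[K] K) →ₗ[K] MvPolynomial σ K :=
  ∑ i, (LinearMap.applyₗ (Pi.single i 1)).smulRight (X i)

lemma linForm_apply (φ : (σ → K) →ₗ[K] K) :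
    linForm φ = ∑ i, φ (Pi.single i 1) • (X i : MvPolynomial σ K) := by
  simp [linForm]

lemma apply_eq_sum_single (φ : (σ → K) →ₗ[K] K) (v : σ → K) :
    φ v = ∑ i, φ (Pi.single i 1) * v i := by
  rw [LinearMap.pi_apply_eq_sum_univ φ v]
  refine Finset.sum_congr rfl fun i _ ↦ ?_
  rw [smul_eq_mul, mul_comm]
  congr 2
  ext j
  simp [Pi.single_apply, eq_comm]

lemma eval_linForm (φ : (σ → K) →ₗ[K] K) (v : σ → K) : eval v (linForm φ) = φ v := by
  rw [linForm_apply, map_sum, apply_eq_sum_single φ v]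
  simp only [smul_eval, eval_X]

lemma exists_linForm_eq {F : MvPolynomial σ K} (hF : F.IsHomogeneous 1) :
    ∃ φ : (σ → K) →ₗ[K] K, linForm φ = F := by
  have hF' : F ∈ homogeneousSubmodule σ K 1 := hF
  rw [homogeneousSubmodule_one_eq_span_X] at hF'
  suffices h : Submodule.span K (Set.range X) ≤ LinearMap.range (linForm (K := K) (σ := σ)) from
    h hF'
  rw [Submodule.span_le]
  rintro _ ⟨i, rfl⟩
  refine ⟨LinearMap.proj i, ?_⟩
  simp [linForm_apply, Pi.single_apply]

end LinForm

/-! ### Minors -/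

section Minors

variable {R : Type*} [CommRing R]

lemma minor_mem_minorIdeal {m n : Type*} (M : Matrix m n R) {a b : m} (hab : a ≠ b) (i j : n) :
    M a i * M b j - M a j * M b i ∈ minorIdeal 2 M := by
  rcases eq_or_ne i j with rfl | hij
  · simp
  · refine Ideal.subset_span ⟨⟨![a, b], ?_⟩, ⟨![i, j], ?_⟩, ?_⟩
    · intro s t hst
      fin_cases s <;> fin_cases t <;> simp_all
    · intro s t hst
      fin_cases s <;> fin_cases t <;> simp_all
    · rw [Matrix.det_fin_two]; rfl

lemma minorIdeal_le {m n : Type*} {M : Matrix m n R} {I : Ideal R}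
    (h : ∀ a b, a ≠ b → ∀ i j, M a i * M b j - M a j * M b i ∈ I) : minorIdeal 2 M ≤ I := by
  refine Ideal.span_le.2 ?_
  rintro _ ⟨r, c, rfl⟩
  rw [Matrix.det_fin_two]
  exact h _ _ (r.injective.ne (by decide)) _ _

lemma minorIdeal_eraseFirstRow_le {n : Type*} {k : ℕ} (A : Matrix (Fin (k + 1)) n R) :
    minorIdeal 2 (eraseFirstRow A) ≤ minorIdeal 2 A :=
  minorIdeal_le fun _ _ hab i j ↦
    minor_mem_minorIdeal A ((Fin.succ_injective k).ne hab) i j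

/-- The `2 × 2` minors vanish wherever all rows are multiples of one vector. -/
lemma minorIdeal_le_ker_of_rows {S m n : Type*} [CommRing S] (φ : R →+* S) {M : Matrix m n R}
    (u : n → S) (h : ∀ a, ∃ x : S, ∀ i, φ (M a i) = x * u i) :
    minorIdeal 2 M ≤ RingHom.ker φ := by
  refine minorIdeal_le fun a b _ i j ↦ ?_
  obtain ⟨x, hx⟩ := h a
  obtain ⟨y, hy⟩ := h b
  rw [RingHom.mem_ker, map_sub, map_mul, map_mul, hx, hx, hy, hy]
  ring

lemma rank_lt_two_iff {K n : Type*} [Field K] [Fintype n] (M : Matrix (Fin 2) n K) :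
    M.rank < 2 ↔ ∃ s t : K, (s ≠ 0 ∨ t ≠ 0) ∧ s • M 0 + t • M 1 = 0 := by
  have h1 : M.rank < 2 ↔ ¬ LinearIndependent K M.row := by
    constructor
    · intro h hli
      have := hli.rank_matrix
      simp at this
      omega
    · intro h
      rw [Matrix.rank_eq_finrank_span_row]
      refine lt_of_le_of_ne ?_ fun h2 ↦ h ?_
      · exact (finrank_range_le_card (R := K) M.row).trans (by simp)
      · rw [linearIndependent_iff_card_eq_finrank_span, Set.finrank, h2, Fintype.card_fin]
  have h2 : M.row = ![M 0, M 1] := by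
    ext i; fin_cases i <;> rfl
  rw [h1, h2, LinearIndependent.pair_iff]
  push Not
  refine exists_congr fun s ↦ exists_congr fun t ↦ ?_
  tauto

end Minors

/-! ### Forms vanishing at the three points -/

section Forms

open MvPolynomial

variable {K σ : Type*} [Field K]

/-- If the linear forms are spanned by `Y i` and `Z k`, and all products of two of these except the
squares of the `Y i` lie in `I`, then modulo `I` every form of degree `n + 2` is a combination of
the powers `Y i ^ (n + 2)`. -/
lemma homogeneousSubmodule_le_span_pow_sup {ι κ : Type*} {Y : ι → MvPolynomial σ K}
    {Z : κ → MvPolynomial σ K} {I : Ideal (MvPolynomial σ K)}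
    (hspan : homogeneousSubmodule σ K 1 ≤ Submodule.span K (Set.range Y ∪ Set.range Z))
    (hYY : ∀ i j, i ≠ j → Y i * Y j ∈ I) (hZY : ∀ k i, Z k * Y i ∈ I)
    (hZZ : ∀ k k', Z k * Z k' ∈ I) (n : ℕ) :
    homogeneousSubmodule σ K (n + 2) ≤
      Submodule.span K (Set.range fun i ↦ Y i ^ (n + 2)) ⊔ I.restrictScalars K := by
  rw [← homogeneousSubmodule_one_pow]
  have hI : ∀ {N : Submodule K (MvPolynomial σ K)} {x}, x ∈ I → x ∈ N ⊔ I.restrictScalars K :=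
    fun hx ↦ Submodule.mem_sup_right (Submodule.restrictScalars_mem K I _ |>.2 hx)
  have hpow : ∀ (n : ℕ) (i : ι), Y i ^ n ∈
      Submodule.span K (Set.range fun i ↦ Y i ^ n) ⊔ I.restrictScalars K :=
    fun n i ↦ Submodule.mem_sup_left (Submodule.subset_span ⟨i, rfl⟩)
  induction n with
  | zero =>
    rw [zero_add, pow_two]
    refine (mul_le_mul' hspan hspan).trans ?_
    rw [Submodule.span_mul_span, Submodule.span_le]
    rintro _ ⟨_, ⟨i, rfl⟩ | ⟨k, rfl⟩, _, ⟨j, rfl⟩ | ⟨k', rfl⟩, rfl⟩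
    · rcases eq_or_ne i j with rfl | hij
      · refine SetLike.mem_coe.2 ?_
        simpa only [pow_two] using hpow 2 i
      · exact hI (hYY i j hij)
    · exact hI (by simpa only [mul_comm] using hZY k' i)
    · exact hI (hZY k j)
    · exact hI (hZZ k k')
  | succ n ih =>
    rw [pow_succ]
    refine (mul_le_mul' ih hspan).trans ?_
    rw [Submodule.sup_mul, sup_le_iff]
    constructor
    · rw [Submodule.span_mul_span, Submodule.span_le]
      rintro _ ⟨_, ⟨i, rfl⟩, _, ⟨j, rfl⟩ | ⟨k, rfl⟩, rfl⟩
      · rcases eq_or_ne i j with rfl | hij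
        · refine SetLike.mem_coe.2 ?_
          simpa only [pow_succ] using hpow (n + 1 + 2) i
        · refine hI ?_
          simp only [pow_succ _ (n + 1), mul_assoc]
          exact I.mul_mem_left _ (hYY i j hij)
      · refine hI ?_
        simp only [pow_succ _ (n + 1), mul_assoc, mul_comm (Y i) (Z k)]
        exact I.mul_mem_left _ (hZY k i)
    · rw [Submodule.mul_le]
      intro x hx y _
      exact hI (I.mul_mem_right _ hx)

/-- In the situation of `homogeneousSubmodule_le_span_pow_sup`, if `I` vanishes at points dual to
the `Y i`, then a form of degree at least two that vanishes at these points lies in `I`. -/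
lemma mem_of_isHomogeneous_of_eval_eq_zero {ι κ : Type*} [Fintype ι] [DecidableEq ι]
    {Y : ι → MvPolynomial σ K}
    {Z : κ → MvPolynomial σ K} {I : Ideal (MvPolynomial σ K)}
    (hspan : homogeneousSubmodule σ K 1 ≤ Submodule.span K (Set.range Y ∪ Set.range Z))
    (hYY : ∀ i j, i ≠ j → Y i * Y j ∈ I) (hZY : ∀ k i, Z k * Y i ∈ I)
    (hZZ : ∀ k k', Z k * Z k' ∈ I) {P : ι → σ → K}
    (hP : ∀ i j, eval (P i) (Y j) = if i = j then 1 else 0)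
    (hIP : ∀ i, I ≤ RingHom.ker (eval (P i))) {n : ℕ} {F : MvPolynomial σ K}
    (hF : F.IsHomogeneous (n + 2)) (hFP : ∀ i, eval (P i) F = 0) : F ∈ I := by
  obtain ⟨G, hG, H, hH, rfl⟩ := Submodule.mem_sup.1
    (homogeneousSubmodule_le_span_pow_sup hspan hYY hZY hZZ n hF)
  rw [Submodule.restrictScalars_mem] at hH
  obtain ⟨c, rfl⟩ := (Submodule.mem_span_range_iff_exists_fun K).1 hG
  have hc : c = 0 := by
    ext i
    have h1 := hFP i
    have h2 : eval (P i) H = 0 := hIP i hH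
    simpa [h2, hP, smul_eval, ite_pow] using h1
  simpa [hc] using hH

end Forms

namespace IsThreePointPencil

variable {K E : Type*} [Field K] [CharZero K] [AddCommGroup E] [Module K E]
  [FiniteDimensional K E] {ω : LinearMap.BilinForm K E}

/-- Coordinates of `E` that bring the pencil to normal form: they are dual to the three vectors over
the points, and their columns in the `2 × dim E` matrix are `(y₀, 0)`, `(0, y₁)`, `(y₂, y₂)`. -/
lemma exists_coordinates {V : Type*} [AddCommGroup V] [Module K V] {R S : V →ₗ[K] E} {p q r : V}
    (hE : Module.finrank K E = 6) (hω : ω.IsAlt) (hn : ω.Nondegenerate)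
    (h : IsThreePointPencil ω R S p q r) :
    ∃ φ₀ φ₁ φ₂ : E →ₗ[K] K,
      (φ₀ (R p) = 1 ∧ φ₀ (R r) = 0 ∧ ∀ v, φ₀ (S v) = 0) ∧
      (φ₁ (S q) = 1 ∧ φ₁ (R r) = 0 ∧ ∀ v, φ₁ (R v) = 0) ∧
      (φ₂ (R p) = 0 ∧ φ₂ (R r) = 1 ∧ ∀ v, φ₂ (R v) = φ₂ (S v)) := by
  obtain ⟨φ₀, h1, -, h2, h3⟩ := h.exists_dual hE hω hn
  obtain ⟨φ₁, h4, -, h5, h6⟩ := (h.swap hω).exists_dual hE hω hn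
  obtain ⟨φ₂, h7, h8, -, h10⟩ := (h.rotate hω).exists_dual hE hω hn
  refine ⟨φ₀, φ₁, -φ₂, ⟨h1, h2, h3⟩, ⟨h4, by rwa [h.R_r], h6⟩, ?_, ?_, fun v ↦ ?_⟩
  · simpa [h.S_p] using h8
  · simpa [h.R_r] using h7
  · simpa [sub_eq_zero] using h10 v

variable {σ : Type*} [Fintype σ] [DecidableEq σ] {R S : (σ → K) →ₗ[K] E} {p q r : σ → K}

/-- An ideal that contains the `2 × 2` minors of a three point pencil and vanishes at the three
points contains every form of degree at least two that vanishes there. -/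
lemma mem_of_isHomogeneous (hE : Module.finrank K E = 6) (hω : ω.IsAlt) (hn : ω.Nondegenerate)
    (h : IsThreePointPencil ω R S p q r) {I : Ideal (MvPolynomial σ K)}
    (hI : ∀ c d : E →ₗ[K] K,
      linForm (c ∘ₗ R) * linForm (d ∘ₗ S) - linForm (d ∘ₗ R) * linForm (c ∘ₗ S) ∈ I)
    (hIp : I ≤ RingHom.ker (MvPolynomial.eval p)) (hIq : I ≤ RingHom.ker (MvPolynomial.eval q))
    (hIr : I ≤ RingHom.ker (MvPolynomial.eval r)) {n : ℕ} {F : MvPolynomial σ K}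
    (hF : F.IsHomogeneous (n + 2)) (hFp : MvPolynomial.eval p F = 0)
    (hFq : MvPolynomial.eval q F = 0) (hFr : MvPolynomial.eval r F = 0) : F ∈ I := by
  obtain ⟨φ₀, φ₁, φ₂, ⟨h0p, h0r, h0⟩, ⟨h1q, h1r, h1⟩, ⟨h2p, h2r, h2⟩⟩ :=
    h.exists_coordinates hE hω hn
  have zero_of : ∀ {c : E →ₗ[K] K} {T : (σ → K) →ₗ[K] E}, (∀ v, c (T v) = 0) → c ∘ₗ T = 0 :=
    fun hc ↦ LinearMap.ext hc
  -- products of entries in columns of the three types `(y, 0)`, `(0, y)`, `(y, y)`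
  have H01 : ∀ c d : E →ₗ[K] K, (∀ v, c (S v) = 0) → (∀ v, d (R v) = 0) →
      linForm (c ∘ₗ R) * linForm (d ∘ₗ S) ∈ I := fun c d hc hd ↦ by
    simpa [zero_of hc, zero_of hd] using hI c d
  have H02 : ∀ c d : E →ₗ[K] K, (∀ v, c (S v) = 0) → (∀ v, d (R v) = d (S v)) →
      linForm (c ∘ₗ R) * linForm (d ∘ₗ R) ∈ I := fun c d hc hd ↦ by
    have : d ∘ₗ R = d ∘ₗ S := LinearMap.ext hd
    simpa [zero_of hc, this] using hI c d
  have H12 : ∀ c d : E →ₗ[K] K, (∀ v, c (R v) = 0) → (∀ v, d (R v) = d (S v)) →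
      linForm (c ∘ₗ S) * linForm (d ∘ₗ R) ∈ I := fun c d hc hd ↦ by
    simpa [zero_of hc, mul_comm] using hI c d
  set y₀ := φ₀ ∘ₗ R with hy₀
  set y₁ := φ₁ ∘ₗ S with hy₁
  set y₂ := φ₂ ∘ₗ R with hy₂
  set l := ω (R p) ∘ₗ R with hl
  set k := ω (S q) ∘ₗ S with hk
  set m := ω (R r) ∘ₗ R with hm
  have t0 := h.form_p_S
  have t1 := h.form_q_R hω
  have t2 : ∀ v, ω (R r) (R v) = ω (R r) (S v) := fun v ↦ (h.form_r hω v).symm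
  have lp : l p = 0 := hω.self_eq_zero _
  have lq : l q = 0 := by simp [hl, h.R_q]
  have lr : l r = 0 := by simp [hl, h.R_r, t0]
  have kp : k p = 0 := by simp [hk, h.S_p]
  have kq : k q = 0 := hω.self_eq_zero _
  have kr : k r = 0 := by simp [hk, ← h.R_r, t1]
  have mp : m p = 0 := by simp [hm, t2, h.S_p]
  have mq : m q = 0 := by simp [hm, h.R_q]
  have mr : m r = 0 := hω.self_eq_zero _
  -- any two of `l`, `k`, `m` cut out the span of the three points
  have hlm : ∀ v, l v = 0 → m v = 0 → ∃ x y z : K, v = x • p + y • q + z • r :=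
    fun v hv hv' ↦ h.mem_span_of_form_eq_zero hE hω hn hv hv'
  have hkm : ∀ v, k v = 0 → m v = 0 → ∃ x y z : K, v = x • p + y • q + z • r := by
    intro v hv hv'
    obtain ⟨a, b, c, habc⟩ := (h.swap hω).mem_span_of_form_eq_zero hE hω hn hv
      (by rw [← h.R_r, ← t2]; exact hv')
    exact ⟨b, a, c, by rw [habc]; module⟩
  have hlk : ∀ v, l v = 0 → k v = 0 → ∃ x y z : K, v = x • p + y • q + z • r := by
    intro v hv hv'
    have hv : ω (R p) (R v) = 0 := hv
    have hv' : ω (S q) (S v) = 0 := hv'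
    obtain ⟨a, b, c, habc⟩ := (h.transpose hω).mem_span_of_form_eq_zero hE hω hn (v := v)
      (by simp [h.S_p, hv, t0]) (by simp [h.R_q, hv', t1])
    exact ⟨a, c, b, by rw [habc]; module⟩
  obtain ⟨k₁, k₂, hk'⟩ := eq_combination_of_vanish kp kq kr hlm
  obtain ⟨l₁, l₂, hl'⟩ := eq_combination_of_vanish lp lq lr hkm
  obtain ⟨m₁, m₂, hm'⟩ := eq_combination_of_vanish mp mq mr hlk
  have comb : ∀ {f g u : (σ → K) →ₗ[K] K} {a b : K} {G : MvPolynomial σ K}, u = a • f + b • g →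
      linForm f * G ∈ I → linForm g * G ∈ I → linForm u * G ∈ I := by
    rintro f g u a b G rfl h1 h2
    rw [map_add, map_smul, map_smul, add_mul, smul_mul_assoc, smul_mul_assoc]
    exact I.add_mem (Submodule.smul_of_tower_mem I a h1) (Submodule.smul_of_tower_mem I b h2)
  have cm : ∀ {a b : MvPolynomial σ K}, a * b ∈ I → b * a ∈ I := fun hab ↦ by rwa [mul_comm]
  have ly₁ := H01 _ _ t0 h1
  have ly₂ := H02 _ _ t0 h2
  have lk := H01 _ _ t0 t1
  have lm := H02 _ _ t0 t2
  have ky₀ := cm (H01 _ _ h0 t1)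
  have ky₂ := H12 _ _ t1 h2
  have km := H12 _ _ t1 t2
  have my₀ := cm (H02 _ _ h0 t2)
  have my₁ := cm (H12 _ _ h1 t2)
  have y01 := H01 _ _ h0 h1
  have y02 := H02 _ _ h0 h2
  have y12 := H12 _ _ h1 h2
  have ly₀ := comb hl' ky₀ my₀
  have my₂ := comb hm' ly₂ ky₂
  have ll := comb hl' (cm lk) (cm lm)
  have mm := comb hm' lm km
  refine mem_of_isHomogeneous_of_eval_eq_zero (Y := ![linForm y₀, linForm y₁, linForm y₂])
    (Z := ![linForm l, linForm m]) (P := ![p, q, r]) ?_ ?_ ?_ ?_ ?_ ?_ hF ?_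
  · intro G hG
    obtain ⟨φ, rfl⟩ := exists_linForm_eq hG
    obtain ⟨a, b, hab⟩ := eq_combination_of_vanish (p := p) (q := q) (r := r)
      (φ := φ - φ p • y₀ - φ q • y₁ - φ r • y₂)
      (by simp [hy₀, hy₁, hy₂, h0p, h2p, h.S_p])
      (by simp [hy₀, hy₁, hy₂, h1q, h.R_q])
      (by simp [hy₀, hy₁, hy₂, h0r, ← h.R_r, h1r, h2r]) hlm
    have hφ : φ = φ p • y₀ + φ q • y₁ + φ r • y₂ + a • l + b • m := by
      rw [add_assoc, ← hab]; module
    rw [hφ]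
    simp only [map_add, map_smul]
    have hY : ∀ i, ![linForm y₀, linForm y₁, linForm y₂] i ∈ Submodule.span K
        (Set.range ![linForm y₀, linForm y₁, linForm y₂] ∪ Set.range ![linForm l, linForm m]) :=
      fun i ↦ Submodule.subset_span (Or.inl ⟨i, rfl⟩)
    have hZ : ∀ i, ![linForm l, linForm m] i ∈ Submodule.span K
        (Set.range ![linForm y₀, linForm y₁, linForm y₂] ∪ Set.range ![linForm l, linForm m]) :=
      fun i ↦ Submodule.subset_span (Or.inr ⟨i, rfl⟩)
    exact add_mem (add_mem (add_mem (add_mem (Submodule.smul_mem _ _ (hY 0))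
      (Submodule.smul_mem _ _ (hY 1))) (Submodule.smul_mem _ _ (hY 2)))
      (Submodule.smul_mem _ _ (hZ 0))) (Submodule.smul_mem _ _ (hZ 1))
  · intro i j hij
    fin_cases i <;> fin_cases j
    exacts [absurd rfl hij, y01, y02, cm y01, absurd rfl hij, y12, cm y02, cm y12, absurd rfl hij]
  · intro i j
    fin_cases i <;> fin_cases j
    exacts [ly₀, ly₁, ly₂, my₀, my₁, my₂]
  · intro i j
    fin_cases i <;> fin_cases j
    exacts [ll, lm, cm lm, mm]
  · intro i j
    fin_cases i <;> fin_cases j <;>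
      simp [eval_linForm, hy₀, hy₁, hy₂, h0p, h0r, h1q, ← h.R_r, h1r, h2p, h2r, h.S_p, h.R_q]
  · intro i
    fin_cases i
    exacts [hIp, hIq, hIr]
  · intro i
    fin_cases i
    exacts [hFp, hFq, hFr]

end IsThreePointPencil

/-! ### The symplectic form and the minors of the matrix -/

/-- The standard symplectic form `∑ (v_k w'_k - v'_k w_k)` on `K^ι ⊕ K^ι`. -/
noncomputable def stdSymplectic (K ι : Type*) [Field K] [Fintype ι] :
    LinearMap.BilinForm K (ι ⊕ ι → K) :=
  LinearMap.mk₂ K (fun v w ↦ ∑ k, (v (.inl k) * w (.inr k) - v (.inr k) * w (.inl k)))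
    (fun u v w ↦ by
      rw [← Finset.sum_add_distrib]
      exact Finset.sum_congr rfl fun k _ ↦ by simp only [Pi.add_apply]; ring)
    (fun c v w ↦ by
      rw [smul_eq_mul, Finset.mul_sum]
      exact Finset.sum_congr rfl fun k _ ↦ by simp only [Pi.smul_apply, smul_eq_mul]; ring)
    (fun u v w ↦ by
      rw [← Finset.sum_add_distrib]
      exact Finset.sum_congr rfl fun k _ ↦ by simp only [Pi.add_apply]; ring)
    (fun c v w ↦ by
      rw [smul_eq_mul, Finset.mul_sum]
      exact Finset.sum_congr rfl fun k _ ↦ by simp only [Pi.smul_apply, smul_eq_mul]; ring)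

section StdSymplectic

variable {K ι : Type*} [Field K] [Fintype ι]

lemma stdSymplectic_apply (v w : ι ⊕ ι → K) :
    stdSymplectic K ι v w = ∑ k, (v (.inl k) * w (.inr k) - v (.inr k) * w (.inl k)) := rfl

lemma stdSymplectic_isAlt : (stdSymplectic K ι).IsAlt := fun v ↦ by
  rw [stdSymplectic_apply]
  exact Finset.sum_eq_zero fun k _ ↦ by ring

lemma stdSymplectic_nondegenerate : (stdSymplectic K ι).Nondegenerate := by
  classical
  refine (LinearMap.IsRefl.nondegenerate_iff_separatingLeft
    (show LinearMap.IsRefl (stdSymplectic K ι) from stdSymplectic_isAlt.isRefl)).2 ?_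
  intro v hv
  ext (k | k)
  · simpa [stdSymplectic_apply, Pi.single_apply] using hv (Pi.single (.inr k) 1)
  · simpa [stdSymplectic_apply, Pi.single_apply] using hv (Pi.single (.inl k) 1)

end StdSymplectic

/-- Up to a scalar, base changes of the rows and of the columns turn minors of a matrix of linear
forms into elements of the ideal of its minors. -/
lemma linForm_minor_mem {K σ n : Type*} [Field K] [Fintype σ] [DecidableEq σ] [Fintype n]
    [DecidableEq n] {M : Matrix (Fin 2) n (MvPolynomial σ K)}
    {φ : Fin 2 → n → (σ → K) →ₗ[K] K} (hφ : ∀ i j, linForm (φ i j) = M i j) (a b a' b' : K)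
    (c d : (n → K) →ₗ[K] K) :
    linForm (c ∘ₗ (a • LinearMap.pi (φ 0) + b • LinearMap.pi (φ 1))) *
        linForm (d ∘ₗ (a' • LinearMap.pi (φ 0) + b' • LinearMap.pi (φ 1))) -
      linForm (d ∘ₗ (a • LinearMap.pi (φ 0) + b • LinearMap.pi (φ 1))) *
        linForm (c ∘ₗ (a' • LinearMap.pi (φ 0) + b' • LinearMap.pi (φ 1))) ∈ minorIdeal 2 M := by
  have key : ∀ (c : (n → K) →ₗ[K] K) (i : Fin 2),
      linForm (c ∘ₗ LinearMap.pi (φ i)) = ∑ j, c (Pi.single j 1) • M i j := by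
    intro c i
    have : c ∘ₗ LinearMap.pi (φ i) = ∑ j, c (Pi.single j 1) • φ i j := by
      refine LinearMap.ext fun v ↦ ?_
      rw [LinearMap.comp_apply, apply_eq_sum_single c]
      simp
    rw [this, map_sum]
    simp only [map_smul, hφ]
  have hmem : linForm (c ∘ₗ LinearMap.pi (φ 0)) * linForm (d ∘ₗ LinearMap.pi (φ 1)) -
      linForm (d ∘ₗ LinearMap.pi (φ 0)) * linForm (c ∘ₗ LinearMap.pi (φ 1)) ∈ minorIdeal 2 M := by
    have : linForm (c ∘ₗ LinearMap.pi (φ 0)) * linForm (d ∘ₗ LinearMap.pi (φ 1)) -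
        linForm (d ∘ₗ LinearMap.pi (φ 0)) * linForm (c ∘ₗ LinearMap.pi (φ 1)) =
        ∑ i, ∑ j, (c (Pi.single i 1) * d (Pi.single j 1)) •
          (M 0 i * M 1 j - M 0 j * M 1 i) := by
      simp only [key, smul_sub, Finset.sum_sub_distrib, Finset.sum_mul_sum, smul_mul_smul_comm]
      congr 1
      rw [Finset.sum_comm]
      simp only [mul_comm (d _)]
    rw [this]
    exact Ideal.sum_mem _ fun i _ ↦ Ideal.sum_mem _ fun j _ ↦
      Submodule.smul_of_tower_mem _ _ (minor_mem_minorIdeal M zero_ne_one i j)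
  have := Submodule.smul_of_tower_mem _ (a * b' - b * a') hmem
  convert this using 1
  simp only [LinearMap.comp_add, LinearMap.comp_smul, map_add, map_smul, MvPolynomial.smul_eq_C_mul,
    map_sub, map_mul]
  ring

theorem proposition2p2
    (α β : Matrix (Fin 3) (Fin 3) (MvPolynomial (Fin 5) ℂ))
    (A : Matrix (Fin 3) (Fin 3 ⊕ Fin 3) (MvPolynomial (Fin 5) ℂ))
    (hA : A = Matrix.fromCols α β)
    (hcubic : ∀ j, (A 0 j).IsHomogeneous 3)
    (hlinear : ∀ i j, i ≠ 0 → (A i j).IsHomogeneous 1)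
    (hsymm : α * β.transpose = β * α.transpose)
    (hlocus : (degeneracyLocus (eraseFirstRow A)).ncard = 3) :
    minorIdeal 2 A = minorIdeal 2 (eraseFirstRow A) := by
  set ω := stdSymplectic ℂ (Fin 3) with hω_def
  have hω : ω.IsAlt := stdSymplectic_isAlt
  have hn : ω.Nondegenerate := stdSymplectic_nondegenerate
  have hE : Module.finrank ℂ (Fin 3 ⊕ Fin 3 → ℂ) = 6 := by simp
  have hV : Module.finrank ℂ (Fin 5 → ℂ) = 5 := by simp
  have hrows : ∀ i j (v : Fin 5 → ℂ), ω (fun x ↦ MvPolynomial.eval v (A i x))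
      (fun x ↦ MvPolynomial.eval v (A j x)) = 0 := by
    intro i j v
    have := congrArg (MvPolynomial.eval v) (congrFun (congrFun hsymm i) j)
    simp only [Matrix.mul_apply, Matrix.transpose_apply, map_sum, map_mul] at this
    rw [hω_def, stdSymplectic_apply, Finset.sum_sub_distrib, hA]
    simpa [sub_eq_zero] using this
  choose φ hφ using fun (i : Fin 2) j ↦ exists_linForm_eq (hlinear i.succ j (Fin.succ_ne_zero i))
  have heval : ∀ (i : Fin 2) v, (fun x ↦ MvPolynomial.eval v (A i.succ x)) =
      LinearMap.pi (φ i) v := by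
    intro i v
    ext x
    rw [← hφ, eval_linForm, LinearMap.pi_apply]
  have hmem : ∀ D : ℙ ℂ (Fin 5 → ℂ), D ∈ degeneracyLocus (eraseFirstRow A) ↔
      ∃ s t : ℂ, (s ≠ 0 ∨ t ≠ 0) ∧
        s • LinearMap.pi (φ 0) D.rep + t • LinearMap.pi (φ 1) D.rep = 0 := by
    intro D
    rw [← heval, ← heval]
    exact rank_lt_two_iff ((eraseFirstRow A).map (MvPolynomial.eval D.rep))
  obtain ⟨D₁, D₂, D₃, h12, h13, h23, hD⟩ := Set.ncard_eq_three.1 hlocus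
  have hloc : ∀ v, (∃ s t : ℂ, (s ≠ 0 ∨ t ≠ 0) ∧
      s • LinearMap.pi (φ 0) v + t • LinearMap.pi (φ 1) v = 0) ↔
      ∃ k : ℂ, v = k • D₁.rep ∨ v = k • D₂.rep ∨ v = k • D₃.rep := by
    have hsmul : ∀ (s t k : ℂ) (v : Fin 5 → ℂ),
        s • LinearMap.pi (φ 0) v + t • LinearMap.pi (φ 1) v = 0 →
        s • LinearMap.pi (φ 0) (k • v) + t • LinearMap.pi (φ 1) (k • v) = 0 := by
      intro s t k v hv
      rw [map_smul, map_smul, smul_comm s, smul_comm t, ← smul_add, hv, smul_zero]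
    intro v
    constructor
    · rintro ⟨s, t, hst, hv⟩
      rcases eq_or_ne v 0 with rfl | hv0
      · exact ⟨0, by simp⟩
      obtain ⟨a, ha⟩ := Projectivization.exists_smul_eq_mk_rep ℂ v hv0
      have hin := (hmem (.mk ℂ v hv0)).2 ⟨s, t, hst, by
        rw [← ha, Units.smul_def]; exact hsmul s t _ v hv⟩
      have hva : v = (↑a⁻¹ : ℂ) • (Projectivization.mk ℂ v hv0).rep := by
        rw [← ha, ← Units.smul_def, inv_smul_smul]
      refine ⟨(↑a⁻¹ : ℂ), ?_⟩
      rw [hD] at hin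
      rcases hin with h | h | h <;> rw [h] at hva <;> tauto
    · have : ∀ D ∈ degeneracyLocus (eraseFirstRow A), ∀ k : ℂ, ∃ s t : ℂ, (s ≠ 0 ∨ t ≠ 0) ∧
          s • LinearMap.pi (φ 0) (k • D.rep) + t • LinearMap.pi (φ 1) (k • D.rep) = 0 := by
        intro D hDm k
        obtain ⟨s, t, hst, h⟩ := (hmem D).1 hDm
        exact ⟨s, t, hst, hsmul s t k _ h⟩
      rintro ⟨k, rfl | rfl | rfl⟩ <;> exact this _ (by simp [hD]) k
  have hrow : ∀ (i : Fin 2) (v), ω (fun x ↦ MvPolynomial.eval v (A 0 x))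
      (LinearMap.pi (φ i) v) = 0 := fun i v ↦ by
    rw [← heval]; exact hrows 0 i.succ v
  obtain ⟨a, b, c, d, hdet, h⟩ := exists_isThreePointPencil hω
    (Projectivization.linearIndependent_pair_iff_ne.2 h12)
    (Projectivization.linearIndependent_pair_iff_ne.2 h13)
    (Projectivization.linearIndependent_pair_iff_ne.2 h23)
    (fun v ↦ by rw [← heval, ← heval]; exact hrows _ _ v) hloc
  have hminor := linForm_minor_mem (M := eraseFirstRow A) hφ a b c d
  set R := a • LinearMap.pi (φ 0) + b • LinearMap.pi (φ 1) with hR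
  set S := c • LinearMap.pi (φ 0) + d • LinearMap.pi (φ 1) with hS
  have hcont : ∀ e, Continuous fun v ↦ ω (fun x ↦ MvPolynomial.eval v (A 0 x)) e := by
    intro e
    simp only [hω_def, stdSymplectic_apply]
    have := fun x ↦ MvPolynomial.continuous_eval (A 0 x)
    fun_prop
  have hgR : ∀ v, ω (fun x ↦ MvPolynomial.eval v (A 0 x)) (R v) = 0 := fun v ↦ by
    simp [hR, hrow]
  have hgS : ∀ v, ω (fun x ↦ MvPolynomial.eval v (A 0 x)) (S v) = 0 := fun v ↦ by
    simp [hS, hrow]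
  -- where `R` and `S` are multiples of `u`, so are the two rows of linear forms
  have hker : ∀ (v : Fin 5 → ℂ) (u : Fin 3 ⊕ Fin 3 → ℂ),
      (∃ x : ℂ, (fun j ↦ MvPolynomial.eval v (A 0 j)) = x • u) → (∃ x : ℂ, R v = x • u) →
      (∃ x : ℂ, S v = x • u) → minorIdeal 2 A ≤ RingHom.ker (MvPolynomial.eval v) := by
    rintro v u ⟨x, hx⟩ ⟨y, hy⟩ ⟨z, hz⟩
    have h0 : LinearMap.pi (φ 0) v = ((a * d - b * c)⁻¹ * (d * y - b * z)) • u := by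
      rw [mul_smul, sub_smul, mul_smul, mul_smul, ← hy, ← hz, eq_inv_smul_iff₀ hdet]
      simp only [hR, hS, LinearMap.add_apply, LinearMap.smul_apply]
      module
    have h1 : LinearMap.pi (φ 1) v = ((a * d - b * c)⁻¹ * (a * z - c * y)) • u := by
      rw [mul_smul, sub_smul, mul_smul, mul_smul, ← hy, ← hz, eq_inv_smul_iff₀ hdet]
      simp only [hR, hS, LinearMap.add_apply, LinearMap.smul_apply]
      module
    rw [← heval] at h0 h1
    refine minorIdeal_le_ker_of_rows _ u fun i ↦ ?_
    fin_cases i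
    exacts [⟨_, congrFun hx⟩, ⟨_, congrFun h0⟩, ⟨_, congrFun h1⟩]
  have hp : minorIdeal 2 A ≤ RingHom.ker (MvPolynomial.eval D₁.rep) :=
    hker _ (R D₁.rep) (h.exists_eq_smul_of_orthogonal hE hV hω hn hcont hgR hgS)
      ⟨1, by simp⟩ ⟨0, by simp [h.S_p]⟩
  have hq : minorIdeal 2 A ≤ RingHom.ker (MvPolynomial.eval D₂.rep) :=
    hker _ (S D₂.rep) ((h.swap hω).exists_eq_smul_of_orthogonal hE hV hω hn hcont hgS hgR)
      ⟨0, by simp [h.R_q]⟩ ⟨1, by simp⟩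
  have hr : minorIdeal 2 A ≤ RingHom.ker (MvPolynomial.eval D₃.rep) :=
    hker _ ((-S) D₃.rep) ((h.rotate hω).exists_eq_smul_of_orthogonal hE hV hω hn hcont
      (fun v ↦ by simp [hgS]) (fun v ↦ by simp [hgR, hgS]))
      ⟨-1, by simp [h.R_r]⟩ ⟨-1, by simp⟩
  have hle := minorIdeal_eraseFirstRow_le A
  refine le_antisymm (minorIdeal_le fun i j hij k l ↦ ?_) hle
  by_cases h0 : i ≠ 0 ∧ j ≠ 0
  · obtain ⟨i, rfl⟩ := Fin.exists_succ_eq.2 h0.1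
    obtain ⟨j, rfl⟩ := Fin.exists_succ_eq.2 h0.2
    exact minor_mem_minorIdeal (eraseFirstRow A) (ne_of_apply_ne _ hij) k l
  · have hquartic : (A i k * A j l - A i l * A j k).IsHomogeneous (2 + 2) := by
      rcases eq_or_ne i 0 with rfl | hi
      · exact ((hcubic k).mul (hlinear j l hij.symm)).sub ((hcubic l).mul (hlinear j k hij.symm))
      · obtain rfl : j = 0 := by tauto
        exact ((hlinear i k hij).mul (hcubic l)).sub ((hlinear i l hij).mul (hcubic k))
    have hF := minor_mem_minorIdeal A hij k l
    exact h.mem_of_isHomogeneous hE hω hn hminor (hle.trans hp) (hle.trans hq) (hle.trans hr)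
      hquartic (hp hF) (hq hF) (hr hF)
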